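/- A FIDL-module is a structure $\mathcal M=\langle \mathbf A,\mathbf B,f,i\rangle$ in which $\mathbf A$ and $\mathbf B$ are bounded distributive lattices and $f\colon A\times B\to A$, $i\colon B\times A\to A$ are functions such that, for all $x,y\in A$ and $b,c\in B$, (F1) $f(x\vee y,b)=f(x,b)\vee f(y,b)$; (F2) $f(x,b\vee c)=f(x,b)\vee f(x,c)$; (F3) $f(0,b)=0$; (F4) $f(x,0)=0$; (I1) $i(b,x\wedge y)=i(b,x)\wedge i(b,y)$; (I2) $i(b\vee c,x)=i(b,x)\wedge i(c,x)$; (I3) $i(b,1)=1$; (I4) $i(0,x)=1$. A FIDL-homomorphism $\langle \mathbf A,\mathbf B,f,i\rangle\to\langle \hat{\mathbf A},\hat{\mathbf B},\hat f,\hat i\rangle$ is a pair $(\alpha,\gamma)$ of homomorphisms of bounded lattices $\alpha\colon A\to\hat A$, $\gamma\colon B\to\hat B$ with $\alpha(f(x,b))=\hat f(\alpha(x),\gamma(b))$ and $\alpha(i(b,x))=\hat i(\gamma(b),\alpha(x))$ for all $x\in A$, $b\in B$. Let $\mathsf{FIMod}$ be the category of FIDL-modules and FIDL-homomorphisms, with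 componentwise composition. A Priestley space is a compact topological space with a partial order such that whenever $x\not\le y$ there is a clopen increasing set containing $x$ but not $y$. For a Priestley space $X$ let $\mathcal C(X)$ be the set of its clopen increasing subsets, and for $x\in X$ let $\epsilon_X(x)=\{U\in\mathcal C(X): x\in U\}$. Let $X$, $Y$ be Priestley spaces, $R\subseteq X\times Y\times X$ and $T\subseteq Y\times X\times X$. For $V\subseteq X$ and $U\subseteq Y$ put $$f(V,U)=\{z\in X:\ \exists\, x\in V,\ y\in U \text{ with } (x,y,z)\in R\},$$ $$i(U,V)=\{y\in X:\ \forall x\in Y\ \forall z\in X,\ \text{if } (x,y,z)\in T \text{ and } x\in U, \text{ then } z\in V\},$$ and for $G\subseteq\mathcal C(X)$ and $H\subseteq\mathcal C(Y)$ put $$f(G,H)=\{W\in\mathcal C(X):\ f(V,U)\subseteq W\text{ for some }V\in G,\ U\in H\},$$ $$i(H,G)=\{W\in\mathcal C(X):\ V\subseteq i(U,W)\text{ for some }U\in H,\ V\in G\}.$$ The structure $\mathcal U=\langle X,Y,R,T\rangle$ is an Urquhart space if $f(V,U)\in\mathcal C(X)$ and $i(U,V)\in\mathcal C(X)$ for all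 $V\in\mathcal C(X)$ and $U\in\mathcal C(Y)$, and if for all $x\in Y$ and $y,z\in X$: $f(\epsilon_X(y),\epsilon_Y(x))\subseteq\epsilon_X(z)$ implies $(y,x,z)\in R$, and $i(\epsilon_Y(x),\epsilon_X(y))\subseteq\epsilon_X(z)$ implies $(x,y,z)\in T$. A U-map $\langle X,Y,R,T\rangle\to\langle\hat X,\hat Y,\hat R,\hat T\rangle$ is a pair $(g,h)$ of continuous monotone maps $g\colon X\to\hat X$, $h\colon Y\to\hat Y$ such that (M1) if $(x,y,z)\in R$, then $(g(x),h(y),g(z))\in\hat R$; (M2) if $(\bar x,\bar y,g(z))\in\hat R$, then there are $x\in X$, $y\in Y$ with $(x,y,z)\in R$, $\bar x\le g(x)$ and $\bar y\le h(y)$; (N1) if $(x,y,z)\in T$, then $(h(x),g(y),g(z))\in\hat T$; (N2) if $(\bar x,g(y),\bar z)\in\hat T$, then there are $x\in Y$, $z\in X$ with $(x,y,z)\in T$, $\bar x\le h(x)$ and $g(z)\le\bar z$. Let $\mathsf{USp}$ be the category of Urquhart spaces and U-maps, with componentwise composition. **Theorem.** The categories $\mathsf{FIMod}$ and $\mathsf{USp}$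 are dually equivalent, i.e. $\mathsf{FIMod}^{\mathrm{op}}$ and $\mathsf{USp}$ are equivalent categories. -/

import Mathlib

open CategoryTheory Opposite

universe u v

/-- A FIDL-module `⟨A, B, f, i⟩`: two bounded distributive lattices (possibly trivial) with
`f : A × B → A` and `i : B × A → A`. -/
structure FIMod where
  A : Type u
  B : Type v
  [latA : DistribLattice A]
  [bddA : BoundedOrder A]
  [latB : DistribLattice B]
  [bddB : BoundedOrder B]
  f : A → B → A
  i : B → A → A
  /-- (F1) -/
  f_sup_left : ∀ x y b, f (x ⊔ y) b = f x b ⊔ f y b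
  /-- (F2) -/
  f_sup_right : ∀ x b c, f x (b ⊔ c) = f x b ⊔ f x c
  /-- (F3) -/
  f_bot_left : ∀ b, f ⊥ b = ⊥
  /-- (F4) -/
  f_bot_right : ∀ x, f x ⊥ = ⊥
  /-- (I1) -/
  i_inf : ∀ b x y, i b (x ⊓ y) = i b x ⊓ i b y
  /-- (I2) -/
  i_sup : ∀ b c x, i (b ⊔ c) x = i b x ⊓ i c x
  /-- (I3) -/
  i_top : ∀ b, i b ⊤ = ⊤
  /-- (I4), the counterpart of (F4) -/
  i_bot : ∀ x, i ⊥ x = ⊤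

namespace FIMod

attribute [instance] latA bddA latB bddB

/-- A FIDL-homomorphism: a pair of bounded lattice homomorphisms commuting with `f` and `i`. -/
@[ext]
structure Hom (M N : FIMod.{u, v}) where
  α : BoundedLatticeHom M.A N.A
  γ : BoundedLatticeHom M.B N.B
  map_f : ∀ x b, α (M.f x b) = N.f (α x) (γ b)
  map_i : ∀ b x, α (M.i b x) = N.i (γ b) (α x)

/-- The category of FIDL-modules and FIDL-homomorphisms, with componentwise composition. -/
instance : Category FIMod.{u, v} where
  Hom := Hom
  id M :=
    { α := BoundedLatticeHom.id M.A
      γ := BoundedLatticeHom.id M.B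
      map_f := fun _ _ => rfl
      map_i := fun _ _ => rfl }
  comp φ ψ :=
    { α := ψ.α.comp φ.α
      γ := ψ.γ.comp φ.γ
      map_f := fun x b => by simp [φ.map_f, ψ.map_f]
      map_i := fun b x => by simp [φ.map_i, ψ.map_i] }

end FIMod

namespace Urquhart

section Operations

variable {X : Type u} {Y : Type v}

/-- `f(V, U) = {z | ∃ (x, y) ∈ V × U, (x, y, z) ∈ R}`. -/
def fusion (R : X → Y → X → Prop) (V : Set X) (U : Set Y) : Set X :=
  {z | ∃ x ∈ V, ∃ y ∈ U, R x y z}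

/-- `i(U, V) = {y | ∀ x z, (x, y, z) ∈ T and x ∈ U imply z ∈ V}`. -/
def implication (T : Y → X → X → Prop) (U : Set Y) (V : Set X) : Set X :=
  {y | ∀ x z, T x y z → x ∈ U → z ∈ V}

variable [TopologicalSpace X] [PartialOrder X] [TopologicalSpace Y] [PartialOrder Y]

/-- `ε(x)`, the set of clopen upper sets containing `x`. -/
def epsilon (x : X) : Set (ClopenUpperSet X) :=
  {U | x ∈ U}

/-- `f(G, H) = {W | ∃ (V, U) ∈ G × H, f(V, U) ⊆ W}` for sets `G`, `H` of clopen upper sets. -/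
def fusionFilter (R : X → Y → X → Prop) (G : Set (ClopenUpperSet X))
    (H : Set (ClopenUpperSet Y)) : Set (ClopenUpperSet X) :=
  {W | ∃ V ∈ G, ∃ U ∈ H, fusion R (V : Set X) (U : Set Y) ⊆ (W : Set X)}

/-- `i(H, G) = {W | ∃ (U, V) ∈ H × G, V ⊆ i(U, W)}` for sets `G`, `H` of clopen upper sets. -/
def implicationFilter (T : Y → X → X → Prop) (H : Set (ClopenUpperSet Y))
    (G : Set (ClopenUpperSet X)) : Set (ClopenUpperSet X) :=
  {W | ∃ U ∈ H, ∃ V ∈ G, (V : Set X) ⊆ implication T (U : Set Y) (W : Set X)}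

end Operations

end Urquhart

open Urquhart in
/-- An Urquhart space: Priestley spaces `X`, `Y` (possibly empty) with relations
`R ⊆ X × Y × X` and `T ⊆ Y × X × X`. -/
structure USp where
  X : Type u
  Y : Type v
  [topX : TopologicalSpace X]
  [ordX : PartialOrder X]
  [compactX : CompactSpace X]
  [priestleyX : PriestleySpace X]
  [topY : TopologicalSpace Y]
  [ordY : PartialOrder Y]
  [compactY : CompactSpace Y]
  [priestleyY : PriestleySpace Y]
  R : X → Y → X → Prop
  T : Y → X → X → Prop
  fusion_isClopen : ∀ (V : ClopenUpperSet X) (U : ClopenUpperSet Y),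
    IsClopen (fusion R (V : Set X) (U : Set Y))
  fusion_isUpperSet : ∀ (V : ClopenUpperSet X) (U : ClopenUpperSet Y),
    IsUpperSet (fusion R (V : Set X) (U : Set Y))
  implication_isClopen : ∀ (U : ClopenUpperSet Y) (V : ClopenUpperSet X),
    IsClopen (implication T (U : Set Y) (V : Set X))
  implication_isUpperSet : ∀ (U : ClopenUpperSet Y) (V : ClopenUpperSet X),
    IsUpperSet (implication T (U : Set Y) (V : Set X))
  R_of_subset : ∀ (y : X) (x : Y) (z : X),
    fusionFilter R (epsilon y) (epsilon x) ⊆ epsilon z → R y x z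
  T_of_subset : ∀ (x : Y) (y z : X),
    implicationFilter T (epsilon x) (epsilon y) ⊆ epsilon z → T x y z

namespace USp

attribute [instance] topX ordX compactX priestleyX topY ordY compactY priestleyY

/-- A U-map: a pair of continuous monotone maps satisfying (M1), (M2), (N1), (N2). -/
@[ext]
structure Hom (S S' : USp.{u, v}) where
  g : S.X →Co S'.X
  h : S.Y →Co S'.Y
  /-- (M1) -/
  map_R : ∀ x y z, S.R x y z → S'.R (g x) (h y) (g z)
  /-- (M2) -/
  lift_R : ∀ x' y' z, S'.R x' y' (g z) → ∃ x y, S.R x y z ∧ x' ≤ g x ∧ y' ≤ h y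
  /-- (N1) -/
  map_T : ∀ x y z, S.T x y z → S'.T (h x) (g y) (g z)
  /-- (N2) -/
  lift_T : ∀ x' y z', S'.T x' (g y) z' → ∃ x z, S.T x y z ∧ x' ≤ h x ∧ g z ≤ z'

/-- The category of Urquhart spaces and U-maps, with componentwise composition. -/
instance : Category USp.{u, v} where
  Hom := Hom
  id S :=
    { g := ContinuousOrderHom.id S.X
      h := ContinuousOrderHom.id S.Y
      map_R := fun _ _ _ hR => hR
      lift_R := fun x' y' _ hR => ⟨x', y', hR, le_rfl, le_rfl⟩
      map_T := fun _ _ _ hT => hT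
      lift_T := fun x' _ z' hT => ⟨x', z', hT, le_rfl, le_rfl⟩ }
  comp φ ψ :=
    { g := ψ.g.comp φ.g
      h := ψ.h.comp φ.h
      map_R := fun _ _ _ hR => ψ.map_R _ _ _ (φ.map_R _ _ _ hR)
      lift_R := fun x'' y'' z hR => by
        obtain ⟨x', y', h1, h2, h3⟩ := ψ.lift_R x'' y'' (φ.g z) hR
        obtain ⟨x, y, h4, h5, h6⟩ := φ.lift_R x' y' z h1
        exact ⟨x, y, h4, h2.trans (ψ.g.monotone' h5), h3.trans (ψ.h.monotone' h6)⟩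
      map_T := fun _ _ _ hT => ψ.map_T _ _ _ (φ.map_T _ _ _ hT)
      lift_T := fun x'' y z'' hT => by
        obtain ⟨x', z', h1, h2, h3⟩ := ψ.lift_T x'' (φ.g y) z'' hT
        obtain ⟨x, z, h4, h5, h6⟩ := φ.lift_T x' y z' h1
        exact ⟨x, z, h4, h2.trans (ψ.h.monotone' h5), (ψ.g.monotone' h6).trans h3⟩ }

end USp

/-!
Both functors are those of Priestley duality: a FIDL-module is sent to the spaces of prime filters
of its two lattices, an Urquhart space to its two lattices of clopen upper sets. The operation `f`
is encoded by the relation `R p q r` saying that `f a b ∈ r` for all `a ∈ p` and `b ∈ q`, and it can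
be recovered from `R` because it preserves finite joins in each argument: if `f a b ∈ r` for all `a`
and `b` in two meet-closed sets, then these sets extend to prime filters with the same property, one
argument at a time. Applied to the images of two prime filters under a homomorphism, the same
extension principle gives the lifting condition (M2).

The operation `i` needs no separate argument. Regarded as an operation `B × Aᵒᵈ → Aᵒᵈ` it preserves
finite joins in each argument, and the prime filters of `Aᵒᵈ` are the complements of those of `A`.
-/

open Order OrderDual Topology Urquhart

/-- The prime filters of a bounded lattice `L`, the points of its Priestley dual. Properness and
upward closure are encoded by `⊥ ∉ p` and by the equivalences for `⊓` and `⊔`. -/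
structure PrimeFilter (L : Type*) [Lattice L] [BoundedOrder L] where
  carrier : Set L
  top_mem' : ⊤ ∈ carrier
  bot_notMem' : ⊥ ∉ carrier
  inf_mem_iff' : ∀ a b, a ⊓ b ∈ carrier ↔ a ∈ carrier ∧ b ∈ carrier
  sup_mem_iff' : ∀ a b, a ⊔ b ∈ carrier ↔ a ∈ carrier ∨ b ∈ carrier

namespace PrimeFilter

section Lattice

variable {L L' : Type*} [Lattice L] [BoundedOrder L] [Lattice L'] [BoundedOrder L']

instance : SetLike (PrimeFilter L) L where
  coe := carrier
  coe_injective p q h := by cases p; congr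

instance : PartialOrder (PrimeFilter L) := .ofSetLike (PrimeFilter L) L

variable (p : PrimeFilter L) {a b : L}

theorem top_mem : ⊤ ∈ p := p.top_mem'

theorem bot_notMem : ⊥ ∉ p := p.bot_notMem'

variable {p}

theorem inf_mem_iff : a ⊓ b ∈ p ↔ a ∈ p ∧ b ∈ p := p.inf_mem_iff' a b

theorem sup_mem_iff : a ⊔ b ∈ p ↔ a ∈ p ∨ b ∈ p := p.sup_mem_iff' a b

theorem mem_of_le (hab : a ≤ b) (ha : a ∈ p) : b ∈ p := by
  rw [← inf_eq_left.2 hab, inf_mem_iff] at ha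
  exact ha.2

variable (p) in
theorem infClosed : InfClosed (p : Set L) := fun _ ha _ hb => inf_mem_iff.2 ⟨ha, hb⟩

/-- The preimage of a prime filter under a bounded lattice homomorphism. -/
def comap (φ : BoundedLatticeHom L L') (p : PrimeFilter L') : PrimeFilter L where
  carrier := φ ⁻¹' p
  top_mem' := by simp only [Set.mem_preimage, map_top, SetLike.mem_coe, top_mem]
  bot_notMem' := by
    simp only [Set.mem_preimage, map_bot, SetLike.mem_coe, bot_notMem, not_false_iff]
  inf_mem_iff' a b := by simp only [Set.mem_preimage, map_inf, SetLike.mem_coe, inf_mem_iff]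
  sup_mem_iff' a b := by simp only [Set.mem_preimage, map_sup, SetLike.mem_coe, sup_mem_iff]

theorem comap_mono (φ : BoundedLatticeHom L L') : Monotone (comap φ) :=
  fun _ _ hpq _ ha => hpq ha

/-- The complement of a prime filter is a prime ideal, that is, a prime filter of the order dual. -/
def dualEquiv (L : Type*) [Lattice L] [BoundedOrder L] : PrimeFilter L ≃ PrimeFilter Lᵒᵈ where
  toFun p :=
    { carrier := {a | ofDual a ∉ p}
      top_mem' := p.bot_notMem
      bot_notMem' := not_not.2 p.top_mem
      inf_mem_iff' _ _ := sup_mem_iff.not.trans not_or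
      sup_mem_iff' _ _ := inf_mem_iff.not.trans not_and_or }
  invFun q :=
    { carrier := {a | toDual a ∉ q}
      top_mem' := q.bot_notMem
      bot_notMem' := not_not.2 q.top_mem
      inf_mem_iff' _ _ := (sup_mem_iff (p := q)).not.trans not_or
      sup_mem_iff' _ _ := (inf_mem_iff (p := q)).not.trans not_and_or }
  left_inv _ := SetLike.ext fun _ => not_not
  right_inv _ := SetLike.ext fun _ => not_not

theorem dualEquiv_le_dualEquiv {q : PrimeFilter L} : dualEquiv L p ≤ dualEquiv L q ↔ q ≤ p :=
  Set.compl_subset_compl (s := (p : Set L)) (t := q)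

end Lattice

section Separation

variable {L : Type*} [DistribLattice L] [BoundedOrder L]

/-- The complement of a prime ideal, as a prime filter. -/
def ofPrimeIdeal (J : Ideal L) (hJ : J.IsPrime) : PrimeFilter L where
  carrier := (J : Set L)ᶜ
  top_mem' := hJ.toIsProper.top_notMem
  bot_notMem' := not_not.2 J.bot_mem
  inf_mem_iff' a b := by
    have : a ⊓ b ∈ J ↔ a ∈ J ∨ b ∈ J :=
      ⟨hJ.mem_or_mem, Or.rec (J.lower inf_le_left) (J.lower inf_le_right)⟩
    exact this.not.trans not_or
  sup_mem_iff' a b := Ideal.sup_mem_iff.not.trans not_and_or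

theorem exists_subset_disjoint {F I : Set L} (hF : InfClosed F) (hF₀ : F.Nonempty)
    (hI : SupClosed I) (hI₀ : I.Nonempty) (h : ∀ a ∈ F, ∀ b ∈ I, ¬a ≤ b) :
    ∃ p : PrimeFilter L, F ⊆ p ∧ Disjoint (p : Set L) I := by
  have up_F : IsPFilter (upperClosure F : Set L) := by
    refine .of_def (hF₀.mono subset_upperClosure) ?_ fun hxy hx => (upperClosure F).upper hxy hx
    rintro x ⟨a, ha, hax⟩ y ⟨b, hb, hby⟩
    exact ⟨a ⊓ b, subset_upperClosure (hF ha hb), inf_le_of_left_le hax, inf_le_of_right_le hby⟩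
  have low_I : IsIdeal (lowerClosure I : Set L) := by
    refine ⟨(lowerClosure I).lower, hI₀.mono subset_lowerClosure, ?_⟩
    rintro x ⟨a, ha, hxa⟩ y ⟨b, hb, hyb⟩
    exact ⟨a ⊔ b, subset_lowerClosure (hI ha hb), le_sup_of_le_left hxa, le_sup_of_le_right hyb⟩
  have disj : Disjoint (up_F.toPFilter : Set L) (low_I.toIdeal : Set L) := by
    refine Set.disjoint_left.2 ?_
    rintro c ⟨a, ha, hac⟩ ⟨b, hb, hcb⟩
    exact h a ha b hb (hac.trans hcb)
  obtain ⟨J, hJ, hIJ, hFJ⟩ := DistribLattice.prime_ideal_of_disjoint_filter_ideal disj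
  exact ⟨ofPrimeIdeal J hJ, fun a ha => Set.disjoint_left.1 hFJ (subset_upperClosure ha),
    Set.disjoint_left.2 fun a haJ haI => haJ (hIJ (subset_lowerClosure haI))⟩

theorem exists_mem_notMem_of_not_le {a b : L} (h : ¬a ≤ b) :
    ∃ p : PrimeFilter L, a ∈ p ∧ b ∉ p := by
  obtain ⟨p, ha, hb⟩ := exists_subset_disjoint infClosed_singleton (Set.singleton_nonempty a)
    supClosed_singleton (Set.singleton_nonempty b) (by simpa using h)
  exact ⟨p, Set.singleton_subset_iff.1 ha, Set.disjoint_singleton_right.1 hb⟩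

end Separation

end PrimeFilter

/-- A binary operation preserving finite joins in each argument: a binary normal operator in the
sense of Jónsson and Tarski. Besides the `f` of a FIDL-module this covers its `i`, regarded as an
operation `B × Aᵒᵈ → Aᵒᵈ`. -/
structure IsJoinOperator {A B C : Type*} [SemilatticeSup A] [OrderBot A] [SemilatticeSup B]
    [OrderBot B] [SemilatticeSup C] [OrderBot C] (f : A → B → C) : Prop where
  sup_left : ∀ a a' b, f (a ⊔ a') b = f a b ⊔ f a' b
  sup_right : ∀ a b b', f a (b ⊔ b') = f a b ⊔ f a b'
  bot_left : ∀ b, f ⊥ b = ⊥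
  bot_right : ∀ a, f a ⊥ = ⊥

/-- The ternary relation between prime filters that is dual to a binary operation. -/
def canonicalRel {A B C : Type*} [Lattice A] [BoundedOrder A] [Lattice B] [BoundedOrder B]
    [Lattice C] [BoundedOrder C] (f : A → B → C) (p : PrimeFilter A) (q : PrimeFilter B)
    (r : PrimeFilter C) : Prop :=
  ∀ a ∈ p, ∀ b ∈ q, f a b ∈ r

namespace IsJoinOperator

section Mono

variable {A B C : Type*} [SemilatticeSup A] [OrderBot A] [SemilatticeSup B] [OrderBot B]
  [SemilatticeSup C] [OrderBot C] {f : A → B → C}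

theorem flip (hf : IsJoinOperator f) : IsJoinOperator (Function.swap f) where
  sup_left a a' b := hf.sup_right b a a'
  sup_right a b b' := hf.sup_left b b' a
  bot_left := hf.bot_right
  bot_right := hf.bot_left

theorem mono_left (hf : IsJoinOperator f) (b : B) : Monotone (f · b) := fun a a' h => by
  beta_reduce
  rw [← sup_eq_right.2 h, hf.sup_left]
  exact le_sup_left

theorem mono_right (hf : IsJoinOperator f) (a : A) : Monotone (f a) :=
  hf.flip.mono_left a

end Mono

section Extension

theorem exists_primeFilter_left {A B C : Type*} [DistribLattice A] [BoundedOrder A] [Lattice B]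
    [OrderBot B] [Lattice C] [BoundedOrder C] {f : A → B → C} (hf : IsJoinOperator f)
    {G : Set A} {H : Set B} (hG : InfClosed G) (hG₀ : G.Nonempty) (hH : InfClosed H)
    (hH₀ : H.Nonempty) {r : PrimeFilter C} (h : ∀ a ∈ G, ∀ b ∈ H, f a b ∈ r) :
    ∃ p : PrimeFilter A, G ⊆ p ∧ ∀ a ∈ p, ∀ b ∈ H, f a b ∈ r := by
  have supClosed_bad : SupClosed {a | ∃ b ∈ H, f a b ∉ r} := by
    rintro a ⟨b, hb, hab⟩ a' ⟨b', hb', hab'⟩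
    refine ⟨b ⊓ b', hH hb hb', ?_⟩
    rw [hf.sup_left, PrimeFilter.sup_mem_iff, not_or]
    exact ⟨mt (PrimeFilter.mem_of_le (hf.mono_right a inf_le_left)) hab,
      mt (PrimeFilter.mem_of_le (hf.mono_right a' inf_le_right)) hab'⟩
  have bot_bad : ⊥ ∈ {a | ∃ b ∈ H, f a b ∉ r} :=
    hH₀.imp fun b hb => ⟨hb, by rw [hf.bot_left]; exact r.bot_notMem⟩
  obtain ⟨p, hGp, hp⟩ := PrimeFilter.exists_subset_disjoint hG hG₀ supClosed_bad ⟨⊥, bot_bad⟩ <| by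
    rintro a ha a' ⟨b, hb, ha'b⟩ haa'
    exact ha'b (PrimeFilter.mem_of_le (hf.mono_left b haa') (h a ha b hb))
  exact ⟨p, hGp, fun a ha b hb => by_contra fun hab => Set.disjoint_left.1 hp ha ⟨b, hb, hab⟩⟩

variable {A B C A' B' C' : Type*} [DistribLattice A] [BoundedOrder A] [DistribLattice B]
  [BoundedOrder B] [Lattice C] [BoundedOrder C] {f : A → B → C}

theorem exists_canonicalRel (hf : IsJoinOperator f) {G : Set A} {H : Set B} (hG : InfClosed G)
    (hG₀ : G.Nonempty) (hH : InfClosed H) (hH₀ : H.Nonempty) {r : PrimeFilter C}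
    (h : ∀ a ∈ G, ∀ b ∈ H, f a b ∈ r) :
    ∃ (p : PrimeFilter A) (q : PrimeFilter B), G ⊆ p ∧ H ⊆ q ∧ canonicalRel f p q r := by
  obtain ⟨p, hGp, hp⟩ := hf.exists_primeFilter_left hG hG₀ hH hH₀ h
  obtain ⟨q, hHq, hq⟩ := hf.flip.exists_primeFilter_left hH hH₀ p.infClosed ⟨⊤, p.top_mem⟩
    fun b hb a ha => hp a ha b hb
  exact ⟨p, q, hGp, hHq, fun a ha b hb => hq b hb a ha⟩

theorem mem_iff_exists_canonicalRel (hf : IsJoinOperator f) {a : A} {b : B} {r : PrimeFilter C} :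
    f a b ∈ r ↔ ∃ p, a ∈ p ∧ ∃ q, b ∈ q ∧ canonicalRel f p q r := by
  refine ⟨fun hab => ?_, fun ⟨_, ha, _, hb, h⟩ => h a ha b hb⟩
  obtain ⟨p, q, ha, hb, h⟩ := hf.exists_canonicalRel infClosed_singleton (Set.singleton_nonempty a)
    infClosed_singleton (Set.singleton_nonempty b) (r := r) (by simpa using hab)
  exact ⟨p, Set.singleton_subset_iff.1 ha, q, Set.singleton_subset_iff.1 hb, h⟩

theorem exists_canonicalRel_of_comap [Lattice A'] [BoundedOrder A'] [Lattice B'] [BoundedOrder B']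
    [Lattice C'] [BoundedOrder C'] (hf : IsJoinOperator f) {f' : A' → B' → C'}
    {α : BoundedLatticeHom A' A} {β : BoundedLatticeHom B' B} {γ : BoundedLatticeHom C' C}
    (map_f : ∀ a b, γ (f' a b) = f (α a) (β b)) {p : PrimeFilter A'} {q : PrimeFilter B'}
    {r : PrimeFilter C} (h : canonicalRel f' p q (r.comap γ)) :
    ∃ p' q', canonicalRel f p' q' r ∧ p ≤ p'.comap α ∧ q ≤ q'.comap β := by
  obtain ⟨p', q', hp, hq, hrel⟩ := hf.exists_canonicalRel (r := r)
    (p.infClosed.image α) (.image α ⟨⊤, p.top_mem⟩) (q.infClosed.image β) (.image β ⟨⊤, q.top_mem⟩)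
    <| by
      rintro _ ⟨a, ha, rfl⟩ _ ⟨b, hb, rfl⟩
      rw [← map_f]
      exact h a ha b hb
  exact ⟨p', q', hrel, fun a ha => hp ⟨a, ha, rfl⟩, fun b hb => hq ⟨b, hb, rfl⟩⟩

end Extension

end IsJoinOperator

namespace Urquhart

instance {X : Type*} [TopologicalSpace X] [LE X] : DistribLattice (ClopenUpperSet X) :=
  SetLike.coe_injective.distribLattice _ .rfl .rfl (fun _ _ => rfl) fun _ _ => rfl

/-- The action of a continuous monotone map on clopen upper sets, by preimages. -/
def clopenComap {X Y : Type*} [TopologicalSpace X] [Preorder X] [TopologicalSpace Y] [Preorder Y]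
    (g : X →Co Y) : BoundedLatticeHom (ClopenUpperSet Y) (ClopenUpperSet X) where
  toFun V := ⟨⟨g ⁻¹' V, V.isClopen.preimage g.continuous_toFun⟩, V.upper.preimage g.monotone'⟩
  map_sup' _ _ := rfl
  map_inf' _ _ := rfl
  map_top' := rfl
  map_bot' := rfl

section Compact

variable {X L : Type*} [TopologicalSpace X] [CompactSpace X] [LE X] [Lattice L]
  [BoundedOrder L] {φ : BoundedLatticeHom L (ClopenUpperSet X)}

theorem exists_mem_and_le_of_separating (hφ : ∀ x y, (∀ a, x ∈ φ a → y ∈ φ a) → x ≤ y)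
    {U : ClopenUpperSet X} {x : X} (hx : x ∈ U) : ∃ a, x ∈ φ a ∧ φ a ≤ U := by
  suffices ∃ a, x ∈ φ a ∧ Disjoint (U : Set X)ᶜ (φ a) from
    this.imp fun a ha => ⟨ha.1, Set.disjoint_compl_left_iff_subset.1 ha.2⟩
  refine U.isClopen.compl.isClosed.isCompact.induction_on
    (p := fun s => ∃ a, x ∈ φ a ∧ Disjoint s (φ a)) ⟨⊤, by simp [← SetLike.mem_coe]⟩ ?_ ?_ ?_
  · exact fun s t hst ⟨a, ha, hat⟩ => ⟨a, ha, hat.mono_left hst⟩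
  · rintro s t ⟨a, ha, hs⟩ ⟨b, hb, ht⟩
    refine ⟨a ⊓ b, ?_, ?_⟩ <;> rw [map_inf]
    · exact ⟨ha, hb⟩
    · exact Set.disjoint_union_left.2
        ⟨hs.mono_right Set.inter_subset_left, ht.mono_right Set.inter_subset_right⟩
  · intro y hy
    obtain ⟨a, hxa, hya⟩ : ∃ a, x ∈ φ a ∧ y ∉ φ a := by
      by_contra! h
      exact hy (U.upper (hφ x y h) hx)
    exact ⟨(φ a : Set X)ᶜ, mem_nhdsWithin_of_mem_nhds ((φ a).isClopen.compl.isOpen.mem_nhds hya),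
      a, hxa, disjoint_compl_left⟩

theorem surjective_of_separating (hφ : ∀ x y, (∀ a, x ∈ φ a → y ∈ φ a) → x ≤ y) :
    Function.Surjective φ := fun U => by
  suffices ∃ a, (U : Set X) ⊆ φ a ∧ φ a ≤ U from this.imp fun a ha => le_antisymm ha.2 ha.1
  refine U.isClopen.isClosed.isCompact.induction_on (p := fun s => ∃ a, s ⊆ φ a ∧ φ a ≤ U)
    ⟨⊥, Set.empty_subset _, by rw [map_bot]; exact bot_le⟩ ?_ ?_ ?_
  · exact fun s t hst ⟨a, hta, ha⟩ => ⟨a, hst.trans hta, ha⟩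
  · rintro s t ⟨a, hsa, ha⟩ ⟨b, htb, hb⟩
    exact ⟨a ⊔ b, by rw [map_sup]; exact Set.union_subset_union hsa htb,
      by rw [map_sup]; exact sup_le ha hb⟩
  · intro x hx
    obtain ⟨a, hxa, ha⟩ := exists_mem_and_le_of_separating hφ hx
    exact ⟨φ a, mem_nhdsWithin_of_mem_nhds ((φ a).isClopen.isOpen.mem_nhds hxa), a, subset_rfl, ha⟩

end Compact

end Urquhart

namespace PrimeFilter

section Topology

variable {L L' : Type*} [Lattice L] [BoundedOrder L] [Lattice L'] [BoundedOrder L']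

/-- The topology of pointwise convergence of indicator functions. -/
noncomputable instance : TopologicalSpace (PrimeFilter L) :=
  .induced (fun p => (p : Set L).boolIndicator) inferInstance

theorem continuous_iff_isClopen {Z : Type*} [TopologicalSpace Z] {g : Z → PrimeFilter L} :
    Continuous g ↔ ∀ a, IsClopen {z | a ∈ g z} := by
  rw [continuous_induced_rng, continuous_pi_iff]
  refine forall_congr' fun a => ?_
  rw [continuous_bool_rng true]
  simp only [Function.comp_apply, Set.preimage, Set.mem_singleton_iff, ← Set.mem_iff_boolIndicator,
    SetLike.mem_coe]

theorem isClopen_setOf_mem (a : L) : IsClopen {p : PrimeFilter L | a ∈ p} :=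
  continuous_iff_isClopen.1 continuous_id a

theorem continuous_comap (φ : BoundedLatticeHom L L') : Continuous (comap φ) :=
  continuous_iff_isClopen.2 fun a => isClopen_setOf_mem (φ a)

/-- The ultraproduct of prime filters. -/
def ultrafilterLim (𝒰 : Ultrafilter (PrimeFilter L)) : PrimeFilter L where
  carrier := {a | ∀ᶠ p in (𝒰 : Filter (PrimeFilter L)), a ∈ p}
  top_mem' := .of_forall top_mem
  bot_notMem' := by simp [bot_notMem, 𝒰.neBot.ne]
  inf_mem_iff' a b := by simp [inf_mem_iff]
  sup_mem_iff' a b := by simp [sup_mem_iff, Ultrafilter.eventually_or]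

theorem le_nhds_ultrafilterLim (𝒰 : Ultrafilter (PrimeFilter L)) :
    (𝒰 : Filter (PrimeFilter L)) ≤ 𝓝 (ultrafilterLim 𝒰) := by
  rw [nhds_induced, ← Filter.tendsto_iff_comap, tendsto_pi_nhds]
  intro a
  refine tendsto_nhds_of_eventually_eq ?_
  by_cases ha : a ∈ ultrafilterLim 𝒰
  · filter_upwards [show ∀ᶠ p in (𝒰 : Filter (PrimeFilter L)), a ∈ p from ha] with p hp
    exact ((Set.mem_iff_boolIndicator _ a).1 hp).trans ((Set.mem_iff_boolIndicator _ a).1 ha).symm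
  · filter_upwards [Ultrafilter.eventually_not.2 ha] with p hp
    exact ((Set.notMem_iff_boolIndicator _ a).1 hp).trans
      ((Set.notMem_iff_boolIndicator _ a).1 ha).symm

instance : CompactSpace (PrimeFilter L) :=
  ⟨isCompact_iff_ultrafilter_le_nhds.2 fun 𝒰 _ => ⟨_, trivial, le_nhds_ultrafilterLim 𝒰⟩⟩

/-- The Stone map, sending `a` to the clopen upper set of prime filters containing `a`. -/
def stoneHom (L : Type*) [Lattice L] [BoundedOrder L] :
    BoundedLatticeHom L (ClopenUpperSet (PrimeFilter L)) where
  toFun a := ⟨⟨{p | a ∈ p}, isClopen_setOf_mem a⟩, fun _ _ hpq hp => hpq hp⟩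
  map_sup' _ _ := SetLike.ext fun _ => sup_mem_iff
  map_inf' _ _ := SetLike.ext fun _ => inf_mem_iff
  map_top' := SetLike.ext fun p => iff_of_true p.top_mem trivial
  map_bot' := SetLike.ext fun p => iff_of_false p.bot_notMem id

instance : PriestleySpace (PrimeFilter L) where
  priestley {p q} hpq := by
    obtain ⟨a, hp, hq⟩ := Set.not_subset.1 hpq
    exact ⟨stoneHom L a, (stoneHom L a).isClopen, (stoneHom L a).upper, hp, hq⟩

end Topology

section Stone

variable {L : Type*} [DistribLattice L] [BoundedOrder L]

theorem stoneHom_le_stoneHom {a b : L} : stoneHom L a ≤ stoneHom L b ↔ a ≤ b := by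
  refine ⟨fun h => by_contra fun hab => ?_, fun h => OrderHomClass.mono _ h⟩
  obtain ⟨p, ha, hb⟩ := exists_mem_notMem_of_not_le hab
  exact hb (h ha)

theorem stoneHom_surjective : Function.Surjective (stoneHom L) :=
  Urquhart.surjective_of_separating fun _ _ h => h

/-- Priestley representation: a bounded distributive lattice is isomorphic to the lattice of clopen
upper sets of its space of prime filters. -/
noncomputable def stoneIso (L : Type*) [DistribLattice L] [BoundedOrder L] :
    L ≃o ClopenUpperSet (PrimeFilter L) :=
  RelIso.ofSurjective (OrderEmbedding.ofMapLEIff (stoneHom L) fun _ _ => stoneHom_le_stoneHom)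
    stoneHom_surjective

end Stone

section Points

variable {X : Type*} [TopologicalSpace X] [PartialOrder X]

/-- `ε(x)` as a prime filter. -/
def ofPoint (x : X) : PrimeFilter (ClopenUpperSet X) where
  carrier := Urquhart.epsilon x
  top_mem' := trivial
  bot_notMem' := id
  inf_mem_iff' _ _ := Iff.rfl
  sup_mem_iff' _ _ := Iff.rfl

theorem continuous_ofPoint : Continuous (ofPoint (X := X)) :=
  continuous_iff_isClopen.2 fun U => U.isClopen

theorem ofPoint_le_ofPoint [PriestleySpace X] {x y : X} : ofPoint x ≤ ofPoint y ↔ x ≤ y := by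
  refine ⟨fun h => by_contra fun hxy => ?_, fun h U hU => U.upper h hU⟩
  obtain ⟨U, hU, hU', hx, hy⟩ := exists_isClopen_upper_of_not_le hxy
  exact hy (h (show ⟨⟨U, hU⟩, hU'⟩ ∈ ofPoint x from hx))

theorem exists_nhds_inter_subset_of_ofPoint_ne {p : PrimeFilter (ClopenUpperSet X)} {x : X}
    (h : ofPoint x ≠ p) : ∃ t ∈ 𝓝 x, ∃ V ∈ p, ∃ W ∉ p, (V : Set X) ∩ t ⊆ W := by
  obtain ⟨U, hU⟩ : ∃ U, ¬(x ∈ U ↔ U ∈ p) := by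
    by_contra! hx
    exact h (SetLike.ext hx)
  by_cases hUp : U ∈ p
  · have hxU : x ∉ U := fun hx => hU (iff_of_true hx hUp)
    exact ⟨(U : Set X)ᶜ, U.isClopen.compl.isOpen.mem_nhds hxU, U, hUp, ⊥, p.bot_notMem, by simp⟩
  · have hxU : x ∈ U := by_contra fun hx => hU (iff_of_false hx hUp)
    exact ⟨U, U.isClopen.isOpen.mem_nhds hxU, ⊤, p.top_mem, U, hUp, by simp⟩

theorem ofPoint_surjective [CompactSpace X] : Function.Surjective (ofPoint (X := X)) := by
  intro p
  by_contra! h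
  have cover : ∃ V ∈ p, ∃ W ∉ p, (V : Set X) ∩ Set.univ ⊆ W := by
    refine isCompact_univ.induction_on (p := fun s => ∃ V ∈ p, ∃ W ∉ p, (V : Set X) ∩ s ⊆ W)
      ⟨⊤, p.top_mem, ⊥, p.bot_notMem, by simp⟩ ?_ ?_ ?_
    · exact fun s t hst ⟨V, hV, W, hW, hVW⟩ =>
        ⟨V, hV, W, hW, (Set.inter_subset_inter_right _ hst).trans hVW⟩
    · rintro s t ⟨V, hV, W, hW, hs⟩ ⟨V', hV', W', hW', ht⟩
      refine ⟨V ⊓ V', inf_mem_iff.2 ⟨hV, hV'⟩, W ⊔ W', sup_mem_iff.not.2 (not_or.2 ⟨hW, hW'⟩), ?_⟩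
      rintro x ⟨hx, hxs | hxt⟩
      exacts [Or.inl (hs ⟨hx.1, hxs⟩), Or.inr (ht ⟨hx.2, hxt⟩)]
    · intro x _
      rw [nhdsWithin_univ]
      exact exists_nhds_inter_subset_of_ofPoint_ne (h x)
  obtain ⟨V, hV, W, hW, hVW⟩ := cover
  exact hW (mem_of_le (by simpa using hVW) hV)

/-- A Priestley space is order isomorphic to the space of prime filters of its lattice of clopen
upper sets. -/
noncomputable def pointIso (X : Type*) [TopologicalSpace X] [PartialOrder X] [CompactSpace X]
    [PriestleySpace X] : X ≃o PrimeFilter (ClopenUpperSet X) :=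
  RelIso.ofSurjective (OrderEmbedding.ofMapLEIff ofPoint fun _ _ => ofPoint_le_ofPoint)
    ofPoint_surjective

end Points

end PrimeFilter

open PrimeFilter

/-- An operation `B × A → C` regarded as an operation `B × Aᵒᵈ → Cᵒᵈ`. -/
def dualize {A B C : Type*} (i : B → A → C) (b : B) (c : Aᵒᵈ) : Cᵒᵈ := toDual (i b (ofDual c))

section ImplicationRel

variable {A B C : Type*} [Lattice A] [BoundedOrder A] [Lattice B] [BoundedOrder B] [Lattice C]
  [BoundedOrder C]

/-- The ternary relation between prime filters that is dual to an operation whose second argument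
and value are regarded dually, such as the `i` of a FIDL-module. -/
def implicationRel (i : B → A → C) (q : PrimeFilter B) (r : PrimeFilter C) (p : PrimeFilter A) :
    Prop :=
  ∀ b ∈ q, ∀ a, i b a ∈ r → a ∈ p

theorem canonicalRel_dualize {i : B → A → C} {q : PrimeFilter B} {r : PrimeFilter C}
    {p : PrimeFilter A} :
    canonicalRel (dualize i) q (dualEquiv A p) (dualEquiv C r) ↔ implicationRel i q r p :=
  forall₃_congr fun _ _ _ => not_imp_not

end ImplicationRel

namespace IsJoinOperator

section Implication

variable {A B C A' B' C' : Type*} [DistribLattice A] [BoundedOrder A] [DistribLattice B]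
  [BoundedOrder B] [Lattice C] [BoundedOrder C] {i : B → A → C}

theorem mem_iff_forall_implicationRel (hi : IsJoinOperator (dualize i)) {b : B} {a : A}
    {r : PrimeFilter C} : i b a ∈ r ↔ ∀ q p, implicationRel i q r p → b ∈ q → a ∈ p := by
  have h : i b a ∉ r ↔ ∃ q, b ∈ q ∧ ∃ p, a ∉ p ∧ implicationRel i q r p := by
    have h := hi.mem_iff_exists_canonicalRel (a := b) (b := toDual a) (r := dualEquiv C r)
    simp only [(dualEquiv A).surjective.exists, canonicalRel_dualize] at h
    exact h
  refine ⟨fun hr q p hrel hb => hrel b hb a hr, fun hall => by_contra fun hr => ?_⟩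
  obtain ⟨q, hb, p, ha, hrel⟩ := h.1 hr
  exact ha (hall q p hrel hb)

theorem exists_implicationRel_of_comap [Lattice A'] [BoundedOrder A'] [Lattice B'] [BoundedOrder B']
    [Lattice C'] [BoundedOrder C'] (hi : IsJoinOperator (dualize i)) {i' : B' → A' → C'}
    {α : BoundedLatticeHom A' A} {β : BoundedLatticeHom B' B} {γ : BoundedLatticeHom C' C}
    (map_i : ∀ b a, γ (i' b a) = i (β b) (α a)) {q : PrimeFilter B'} {p : PrimeFilter A'}
    {r : PrimeFilter C} (h : implicationRel i' q (r.comap γ) p) :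
    ∃ q' p', implicationRel i q' r p' ∧ q ≤ q'.comap β ∧ p'.comap α ≤ p := by
  obtain ⟨q', p', hrel, hq, hp⟩ := hi.exists_canonicalRel_of_comap (f' := dualize i') (α := β)
    (β := α.dual) (γ := γ.dual) (p := q) (q := dualEquiv A' p) (r := dualEquiv C r) map_i
    fun b hb a => mt (h b hb a)
  obtain ⟨p', rfl⟩ := (dualEquiv A).surjective p'
  exact ⟨q', p', canonicalRel_dualize.1 hrel, hq, dualEquiv_le_dualEquiv.1 hp⟩

end Implication

section Stone

variable {A B : Type*} [DistribLattice A] [BoundedOrder A] [DistribLattice B] [BoundedOrder B]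

theorem fusion_stoneHom {f : A → B → A} (hf : IsJoinOperator f) (a : A) (b : B) :
    fusion (canonicalRel f) (stoneHom A a : Set (PrimeFilter A))
      (stoneHom B b : Set (PrimeFilter B)) = stoneHom A (f a b) :=
  Set.ext fun _ => hf.mem_iff_exists_canonicalRel.symm

theorem implication_stoneHom {i : B → A → A} (hi : IsJoinOperator (dualize i)) (b : B) (a : A) :
    implication (implicationRel i) (stoneHom B b : Set (PrimeFilter B))
      (stoneHom A a : Set (PrimeFilter A)) = stoneHom A (i b a) :=
  Set.ext fun _ => hi.mem_iff_forall_implicationRel.symm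

theorem exists_coe_eq_fusion {f : A → B → A} (hf : IsJoinOperator f)
    (V : ClopenUpperSet (PrimeFilter A)) (U : ClopenUpperSet (PrimeFilter B)) :
    ∃ W : ClopenUpperSet (PrimeFilter A), (W : Set (PrimeFilter A)) =
      fusion (canonicalRel f) (V : Set (PrimeFilter A)) (U : Set (PrimeFilter B)) := by
  obtain ⟨a, rfl⟩ := stoneHom_surjective V
  obtain ⟨b, rfl⟩ := stoneHom_surjective U
  exact ⟨stoneHom A (f a b), (hf.fusion_stoneHom a b).symm⟩

theorem exists_coe_eq_implication {i : B → A → A} (hi : IsJoinOperator (dualize i))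
    (U : ClopenUpperSet (PrimeFilter B)) (V : ClopenUpperSet (PrimeFilter A)) :
    ∃ W : ClopenUpperSet (PrimeFilter A), (W : Set (PrimeFilter A)) =
      implication (implicationRel i) (U : Set (PrimeFilter B)) (V : Set (PrimeFilter A)) := by
  obtain ⟨b, rfl⟩ := stoneHom_surjective U
  obtain ⟨a, rfl⟩ := stoneHom_surjective V
  exact ⟨stoneHom A (i b a), (hi.implication_stoneHom b a).symm⟩

end Stone

end IsJoinOperator

namespace FIMod

section Operators

variable (M : FIMod.{u, v})

theorem isJoinOperator_f : IsJoinOperator M.f :=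
  ⟨M.f_sup_left, M.f_sup_right, M.f_bot_left, M.f_bot_right⟩

theorem isJoinOperator_dualize_i : IsJoinOperator (dualize M.i) :=
  ⟨M.i_sup, M.i_inf, M.i_bot, M.i_top⟩

end Operators

/-- The Urquhart space dual to a FIDL-module. -/
noncomputable def primeSpace (M : FIMod.{u, v}) : USp.{u, v} where
  X := PrimeFilter M.A
  Y := PrimeFilter M.B
  R := canonicalRel M.f
  T := implicationRel M.i
  fusion_isClopen V U :=
    let ⟨W, hW⟩ := M.isJoinOperator_f.exists_coe_eq_fusion V U
    hW ▸ W.isClopen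
  fusion_isUpperSet V U :=
    let ⟨W, hW⟩ := M.isJoinOperator_f.exists_coe_eq_fusion V U
    hW ▸ W.upper
  implication_isClopen U V :=
    let ⟨W, hW⟩ := M.isJoinOperator_dualize_i.exists_coe_eq_implication U V
    hW ▸ W.isClopen
  implication_isUpperSet U V :=
    let ⟨W, hW⟩ := M.isJoinOperator_dualize_i.exists_coe_eq_implication U V
    hW ▸ W.upper
  R_of_subset _ _ _ h a ha b hb :=
    h (show stoneHom M.A (M.f a b) ∈ _ from ⟨stoneHom M.A a, ha, stoneHom M.B b, hb,
      (M.isJoinOperator_f.fusion_stoneHom a b).subset⟩)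
  T_of_subset _ _ _ h b hb a ha :=
    h (show stoneHom M.A a ∈ _ from ⟨stoneHom M.B b, hb, stoneHom M.A (M.i b a), ha,
      (M.isJoinOperator_dualize_i.implication_stoneHom b a).superset⟩)

/-- The U-map dual to a FIDL-homomorphism, by preimages of prime filters. -/
noncomputable def primeHom {M N : FIMod.{u, v}} (φ : M ⟶ N) : N.primeSpace ⟶ M.primeSpace where
  g := ⟨⟨.comap (Hom.α φ), PrimeFilter.comap_mono _⟩, PrimeFilter.continuous_comap _⟩
  h := ⟨⟨.comap (Hom.γ φ), PrimeFilter.comap_mono _⟩, PrimeFilter.continuous_comap _⟩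
  map_R _ _ (r : PrimeFilter N.A) h a ha b hb :=
    (congrArg (· ∈ r) (Hom.map_f φ a b)).mpr (h _ ha _ hb)
  lift_R _ _ _ h := N.isJoinOperator_f.exists_canonicalRel_of_comap (Hom.map_f φ) h
  map_T _ (r : PrimeFilter N.A) _ h b hb a ha :=
    h _ hb _ ((congrArg (· ∈ r) (Hom.map_i φ b a)).mp ha)
  lift_T _ _ _ h := N.isJoinOperator_dualize_i.exists_implicationRel_of_comap (Hom.map_i φ) h

/-- The contravariant functor of prime filters. -/
noncomputable def primeFunctor : FIMod.{u, v}ᵒᵖ ⥤ USp.{u, v} where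
  obj M := M.unop.primeSpace
  map φ := primeHom φ.unop

end FIMod

namespace Urquhart

section Operations

variable {X Y : Type*} (R : X → Y → X → Prop) (T : Y → X → X → Prop)

theorem fusion_union_left (V V' : Set X) (U : Set Y) :
    fusion R (V ∪ V') U = fusion R V U ∪ fusion R V' U := by
  ext z
  simp only [fusion, Set.mem_ofPred_eq, Set.mem_union, or_and_right, exists_or]

theorem fusion_union_right (V : Set X) (U U' : Set Y) :
    fusion R V (U ∪ U') = fusion R V U ∪ fusion R V U' := by
  ext z
  simp only [fusion, Set.mem_ofPred_eq, Set.mem_union, or_and_right, exists_or, and_or_left]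

theorem fusion_empty_left (U : Set Y) : fusion R ∅ U = ∅ := by
  simp [fusion]

theorem fusion_empty_right (V : Set X) : fusion R V ∅ = ∅ := by
  simp [fusion]

theorem implication_inter (U : Set Y) (V V' : Set X) :
    implication T U (V ∩ V') = implication T U V ∩ implication T U V' := by
  ext y
  simp only [implication, Set.mem_ofPred_eq, Set.mem_inter_iff, imp_and, forall_and]

theorem implication_union (U U' : Set Y) (V : Set X) :
    implication T (U ∪ U') V = implication T U V ∩ implication T U' V := by
  ext y
  simp only [implication, Set.mem_ofPred_eq, Set.mem_inter_iff, Set.mem_union, or_imp, imp_and,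
    forall_and]

theorem implication_univ (U : Set Y) : implication T U Set.univ = Set.univ := by
  simp [implication]

theorem implication_empty (V : Set X) : implication T ∅ V = Set.univ := by
  simp [implication]

end Operations

end Urquhart

namespace USp

/-- The FIDL-module of clopen upper sets of an Urquhart space. -/
def clopenModule (S : USp.{u, v}) : FIMod.{u, v} where
  A := ClopenUpperSet S.X
  B := ClopenUpperSet S.Y
  f V U := ⟨⟨fusion S.R V U, S.fusion_isClopen V U⟩, S.fusion_isUpperSet V U⟩
  i U V := ⟨⟨implication S.T U V, S.implication_isClopen U V⟩, S.implication_isUpperSet U V⟩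
  f_sup_left V V' U := SetLike.coe_injective (fusion_union_left S.R V V' U)
  f_sup_right V U U' := SetLike.coe_injective (fusion_union_right S.R V U U')
  f_bot_left U := SetLike.coe_injective (fusion_empty_left S.R (U : Set S.Y))
  f_bot_right V := SetLike.coe_injective (fusion_empty_right S.R (V : Set S.X))
  i_inf U V V' := SetLike.coe_injective (implication_inter S.T U V V')
  i_sup U U' V := SetLike.coe_injective (implication_union S.T U U' V)
  i_top U := SetLike.coe_injective (implication_univ S.T (U : Set S.Y))
  i_bot V := SetLike.coe_injective (implication_empty S.T (V : Set S.X))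

namespace Hom

variable {S S' : USp.{u, v}} (φ : Hom S S')

theorem preimage_fusion {V : Set S'.X} {U : Set S'.Y} (hV : IsUpperSet V) (hU : IsUpperSet U) :
    φ.g ⁻¹' fusion S'.R V U = fusion S.R (φ.g ⁻¹' V) (φ.h ⁻¹' U) := by
  ext z
  constructor
  · rintro ⟨x', hx', y', hy', hR⟩
    obtain ⟨x, y, hR, hx, hy⟩ := φ.lift_R x' y' z hR
    exact ⟨x, hV hx hx', y, hU hy hy', hR⟩
  · rintro ⟨x, hx, y, hy, hR⟩
    exact ⟨φ.g x, hx, φ.h y, hy, φ.map_R x y z hR⟩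

theorem preimage_implication {U : Set S'.Y} {V : Set S'.X} (hU : IsUpperSet U)
    (hV : IsUpperSet V) :
    φ.g ⁻¹' implication S'.T U V = implication S.T (φ.h ⁻¹' U) (φ.g ⁻¹' V) := by
  ext y
  constructor
  · exact fun hy x z hT hx => hy _ _ (φ.map_T x y z hT) hx
  · intro hy x' z' hT hx'
    obtain ⟨x, z, hT, hx, hz⟩ := φ.lift_T x' y z' hT
    exact hV hz (hy x z hT (hU hx hx'))

end Hom

/-- The FIDL-homomorphism dual to a U-map, by preimages of clopen upper sets. -/
def clopenHom {S S' : USp.{u, v}} (φ : S ⟶ S') : S'.clopenModule ⟶ S.clopenModule where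
  α := clopenComap (Hom.g φ)
  γ := clopenComap (Hom.h φ)
  map_f (V : ClopenUpperSet S'.X) U :=
    SetLike.coe_injective (A := ClopenUpperSet S.X) (Hom.preimage_fusion φ V.upper U.upper)
  map_i U (V : ClopenUpperSet S'.X) :=
    SetLike.coe_injective (A := ClopenUpperSet S.X) (Hom.preimage_implication φ U.upper V.upper)

/-- The contravariant functor of clopen upper sets. -/
def clopenFunctor : USp.{u, v} ⥤ FIMod.{u, v}ᵒᵖ where
  obj S := op S.clopenModule
  map φ := (clopenHom φ).op
  map_id _ := rfl
  map_comp _ _ := rfl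

theorem R_iff_ofPoint (S : USp.{u, v}) {x : S.X} {y : S.Y} {z : S.X} :
    S.R x y z ↔ S.clopenModule.primeSpace.R (ofPoint x) (ofPoint y) (ofPoint z) := by
  refine ⟨fun hR V hV U hU => ⟨x, hV, y, hU, hR⟩, fun h => S.R_of_subset x y z ?_⟩
  rintro W ⟨V, hV, U, hU, hVUW⟩
  exact hVUW (h V hV U hU)

theorem T_iff_ofPoint (S : USp.{u, v}) {x : S.Y} {y z : S.X} :
    S.T x y z ↔ S.clopenModule.primeSpace.T (ofPoint x) (ofPoint y) (ofPoint z) := by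
  refine ⟨fun hT U hU V hV => hV x z hT hU, fun h => S.T_of_subset x y z ?_⟩
  rintro W ⟨U, hU, V, hV, hVUW⟩
  exact h U hU W (hVUW hV)

/-- A pair of continuous order isomorphisms identifying the relations, as a U-map. -/
def homOfOrderIso {S S' : USp.{u, v}} (g : S.X ≃o S'.X) (h : S.Y ≃o S'.Y) (hg : Continuous g)
    (hh : Continuous h) (hR : ∀ x y z, S.R x y z ↔ S'.R (g x) (h y) (g z))
    (hT : ∀ x y z, S.T x y z ↔ S'.T (h x) (g y) (g z)) : S ⟶ S' where
  g := ⟨⟨g, g.monotone⟩, hg⟩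
  h := ⟨⟨h, h.monotone⟩, hh⟩
  map_R x y z := (hR x y z).1
  lift_R x' y' z hR' := by
    obtain ⟨x, rfl⟩ := g.surjective x'
    obtain ⟨y, rfl⟩ := h.surjective y'
    exact ⟨x, y, (hR x y z).2 hR', le_rfl, le_rfl⟩
  map_T x y z := (hT x y z).1
  lift_T x' y z' hT' := by
    obtain ⟨x, rfl⟩ := h.surjective x'
    obtain ⟨z, rfl⟩ := g.surjective z'
    exact ⟨x, z, (hT x y z).2 hT', le_rfl, le_rfl⟩

/-- A pair of continuous order isomorphisms identifying the relations is an isomorphism of Urquhart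
spaces. -/
def isoOfOrderIso {S S' : USp.{u, v}} (g : S.X ≃o S'.X) (h : S.Y ≃o S'.Y) (hg : Continuous g)
    (hh : Continuous h) (hR : ∀ x y z, S.R x y z ↔ S'.R (g x) (h y) (g z))
    (hT : ∀ x y z, S.T x y z ↔ S'.T (h x) (g y) (g z)) : S ≅ S' where
  hom := homOfOrderIso g h hg hh hR hT
  inv := homOfOrderIso g.symm h.symm (hg.continuous_symm_of_equiv_compact_to_t2 (f := g.toEquiv))
    (hh.continuous_symm_of_equiv_compact_to_t2 (f := h.toEquiv))
    (fun x y z => by simp [hR]) fun x y z => by simp [hT]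
  hom_inv_id := Hom.ext (ContinuousOrderHom.ext g.symm_apply_apply)
    (ContinuousOrderHom.ext h.symm_apply_apply)
  inv_hom_id := Hom.ext (ContinuousOrderHom.ext g.apply_symm_apply)
    (ContinuousOrderHom.ext h.apply_symm_apply)

end USp

namespace FIMod

/-- A pair of order isomorphisms commuting with `f` and `i` is an isomorphism of FIDL-modules. -/
def isoOfOrderIso {M N : FIMod.{u, v}} (α : M.A ≃o N.A) (γ : M.B ≃o N.B)
    (map_f : ∀ x b, α (M.f x b) = N.f (α x) (γ b))
    (map_i : ∀ b x, α (M.i b x) = N.i (γ b) (α x)) : M ≅ N where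
  hom :=
    { α := α
      γ := γ
      map_f := map_f
      map_i := map_i }
  inv :=
    { α := α.symm
      γ := γ.symm
      map_f := fun x b => α.injective <| by simp [map_f]
      map_i := fun b x => α.injective <| by simp [map_i] }
  hom_inv_id := Hom.ext (BoundedLatticeHom.ext α.symm_apply_apply)
    (BoundedLatticeHom.ext γ.symm_apply_apply)
  inv_hom_id := Hom.ext (BoundedLatticeHom.ext α.apply_symm_apply)
    (BoundedLatticeHom.ext γ.apply_symm_apply)

/-- A FIDL-module is isomorphic to its double dual, by the Stone maps of its two lattices. -/
noncomputable def isoClopenModule (M : FIMod.{u, v}) : M ≅ M.primeSpace.clopenModule :=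
  isoOfOrderIso (N := M.primeSpace.clopenModule) (stoneIso M.A) (stoneIso M.B)
    (fun a b => SetLike.coe_injective (A := ClopenUpperSet (PrimeFilter M.A))
      (M.isJoinOperator_f.fusion_stoneHom a b).symm)
    fun b a => SetLike.coe_injective (A := ClopenUpperSet (PrimeFilter M.A))
      (M.isJoinOperator_dualize_i.implication_stoneHom b a).symm

/-- The natural isomorphism between a FIDL-module and its double dual. -/
noncomputable def doubleDualIso : primeFunctor ⋙ USp.clopenFunctor ≅ 𝟭 FIMod.{u, v}ᵒᵖ :=
  NatIso.ofComponents (fun M => M.unop.isoClopenModule.op) fun _ => rfl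

end FIMod

namespace USp

/-- An Urquhart space is isomorphic to its double dual, by the maps `x ↦ ε(x)`. -/
noncomputable def isoPrimeSpace (S : USp.{u, v}) : S ≅ S.clopenModule.primeSpace :=
  isoOfOrderIso (S' := S.clopenModule.primeSpace) (pointIso S.X) (pointIso S.Y) continuous_ofPoint
    continuous_ofPoint (fun _ _ _ => S.R_iff_ofPoint) fun _ _ _ => S.T_iff_ofPoint

/-- The natural isomorphism between an Urquhart space and its double dual. -/
noncomputable def doubleDualIso : 𝟭 USp.{u, v} ≅ clopenFunctor ⋙ FIMod.primeFunctor :=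
  NatIso.ofComponents isoPrimeSpace fun _ => rfl

end USp

theorem mainTheorem4 : Nonempty (FIMod.{u, v}ᵒᵖ ≌ USp.{u, v}) :=
  ⟨.mk FIMod.primeFunctor USp.clopenFunctor FIMod.doubleDualIso.symm
    USp.doubleDualIso.symm⟩
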